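/- Let $(\mathcal X,d)$ be a metric space with its Borel $\sigma$-algebra $\mathcal B(\mathcal X)$, let $\varepsilon>0$, and let $B_\varepsilon(x)$ denote the open ball of radius $\varepsilon$ around $x$. Let $\mu$ be a probability measure on $\mathcal X\times\{0,1\}$, and put $\rho_i:=\mu(\,\cdot\times\{i\})$ for $i\in\{0,1\}$ and $\rho:=\rho_0+\rho_1$. Assume that $\rho$ is concentrated on its support, $\rho(\mathcal X\setminus\operatorname{supp}\rho)=0$ (this is automatic if $\mathcal X$ is separable). Let $\{\mathfrak m_x\}_{x\in\mathcal X}$ be a measurable family (up to $\rho$-null sets) of Borel measures on $\mathcal X$ such that $\mathfrak m_x$ is a probability measure for $\rho$-almost every $x$. Assume that for every $x\in\operatorname{supp}\rho$: 1. $\mathfrak m_x(\mathcal X\setminus B_\varepsilon(x))=0$; 2. $B_\varepsilon(x)\subseteq\operatorname{supp}\mathfrak m_x$; 3. for every $x'\in\operatorname{supp}\rho$, the restriction of $\mathfrak m_{x'}$ to $B_\varepsilon(x)$ is absolutely continuous with respect to $\mathfrak m_x$. For $\Psi:[0,1]\to[0,1]$ and $A\in\mathcal B(\mathcal X)$ define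 \[ R_\Psi(A)=\int_{\mathcal X}\Psi(\mathfrak m_x(A))\,d\rho_0(x)+\int_{\mathcal X}\Psi(\mathfrak m_x(A^c))\,d\rho_1(x), \] \[ \mathrm{ProbRisk}_\Psi(A)=R_{\mathrm{std}}(A)+\int_{A^c}\Psi(\mathfrak m_x(A))\,d\rho_0(x)+\int_{A}\Psi(\mathfrak m_x(A^c))\,d\rho_1(x), \] where $R_{\mathrm{std}}(A)=\mathbb E_{(x,y)\sim\mu}\big[y\mathbf 1_{A^c}(x)+(1-y)\mathbf 1_A(x)\big]$, and \[ R_{\mathrm{adv}}(A)=\mathbb E_{(x,y)\sim\mu}\big[y\mathbf 1_{(A^c)^{\oplus\varepsilon}}(x)+(1-y)\mathbf 1_{A^{\oplus\varepsilon}}(x)\big],\qquad A^{\oplus\varepsilon}:=\bigcup_{x\in A}B_\varepsilon(x). \] Let $\Psi_p(t)=\min\{t/p,1\}$ for $p>0$ and $\Psi_0(t)=\mathbf 1_{t>0}$. Then all the minima below over $A\in\mathcal B(\mathcal X)$ are attained (those involving $\Psi_p$ for every $p>0$), the limits exist, and \[ \lim_{p\to0^+}\min_{A}R_{\Psi_p}(A)=\min_{A}R_{\Psi_0}(A)=\min_{A}R_{\mathrm{adv}}(A),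 \] \[ \lim_{p\to0^+}\min_{A}\mathrm{ProbRisk}_{\Psi_p}(A)=\min_{A}\mathrm{ProbRisk}_{\Psi_0}(A)=\min_{A}R_{\mathrm{adv}}(A). \] -/

import Mathlib

open MeasureTheory Filter Topology Set
open scoped ENNReal

/-! Binary classification. The data distribution `μ` lives on `X × Fin 2`, the second component being
the label `y ∈ {0, 1}`; a hard classifier is a set `A ⊆ X` (the points that receive the label `1`);
`m x` is the distribution of the perturbations of the point `x`. All risks are integrals of functions
with values in `[0, 1]`, written as `ℝ≥0∞`-valued integrals. -/

namespace ProbRobust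

variable {X : Type*} [MeasurableSpace X]

/-- `ρ_i = μ (· × {i})`, the part of the data distribution that carries the label `i`. -/
noncomputable def labelMeasure (μ : Measure (X × Fin 2)) (i : Fin 2) : Measure X :=
  (μ.restrict {z | z.2 = i}).map Prod.fst

/-- `ρ = μ (· × {0, 1})`, the distribution of all data points irrespective of their label. -/
noncomputable def dataMeasure (μ : Measure (X × Fin 2)) : Measure X :=
  μ.map Prod.fst

/-- Standard risk: the expectation of `y * 1_{Aᶜ}(x) + (1 - y) * 1_A(x)` for `(x, y) ∼ μ`. -/
noncomputable def stdRisk (μ : Measure (X × Fin 2)) (A : Set X) : ℝ≥0∞ :=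
  ∫⁻ z, (if z.2 = 1 then Aᶜ.indicator 1 z.1 else A.indicator 1 z.1) ∂μ

/-- Adversarial risk: as the standard risk, with `A` and `Aᶜ` replaced by their fattenings.
`Metric.thickening ε A` is the union of the open balls `B_ε(x)`, `x ∈ A`. -/
noncomputable def advRisk {X : Type*} [MetricSpace X] [MeasurableSpace X]
    (ε : ℝ) (μ : Measure (X × Fin 2)) (A : Set X) : ℝ≥0∞ :=
  ∫⁻ z, (if z.2 = 1 then (Metric.thickening ε Aᶜ).indicator 1 z.1
    else (Metric.thickening ε A).indicator 1 z.1) ∂μ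

/-- The risk `R_Ψ` of probabilistically robust learning. Only the values of `Ψ` on `[0, 1]`
matter. -/
noncomputable def risk (Ψ : ℝ → ℝ) (m : X → Measure X) (μ : Measure (X × Fin 2)) (A : Set X) :
    ℝ≥0∞ :=
  (∫⁻ x, ENNReal.ofReal (Ψ ((m x).real A)) ∂(labelMeasure μ 0)) +
    ∫⁻ x, ENNReal.ofReal (Ψ ((m x).real Aᶜ)) ∂(labelMeasure μ 1)

/-- The probabilistic perimeter `ProbPer_Ψ`. -/
noncomputable def probPer (Ψ : ℝ → ℝ) (m : X → Measure X) (μ : Measure (X × Fin 2)) (A : Set X) :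
    ℝ≥0∞ :=
  (∫⁻ x in Aᶜ, ENNReal.ofReal (Ψ ((m x).real A)) ∂(labelMeasure μ 0)) +
    ∫⁻ x in A, ENNReal.ofReal (Ψ ((m x).real Aᶜ)) ∂(labelMeasure μ 1)

/-- The risk `ProbRisk_Ψ` of modified probabilistically robust learning. -/
noncomputable def probRisk (Ψ : ℝ → ℝ) (m : X → Measure X) (μ : Measure (X × Fin 2))
    (A : Set X) : ℝ≥0∞ :=
  stdRisk μ A + probPer Ψ m μ A

/-- `Ψ_p(t) = min {t / p, 1}`, used for `p > 0`. -/
noncomputable def psi (p : ℝ) (t : ℝ) : ℝ := min (t / p) 1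

/-- `Ψ_0(t) = 1_{t > 0}`. -/
noncomputable def psiZero (t : ℝ) : ℝ := (Ioi (0 : ℝ)).indicator 1 t

/-- `r` is the minimum of the functional `F` over the measurable sets: it is attained, and it is a
lower bound. -/
def IsMinOverSets (F : Set X → ℝ≥0∞) (r : ℝ≥0∞) : Prop :=
  IsLeast (F '' {A | MeasurableSet A}) r

end ProbRobust

namespace ProbRobust

/-! Minimizers are built without compactness, from submodularity. Each risk with parameter `p > 0`
is an integral of `g x A` over label 0 plus `g x Aᶜ` over label 1. Since `psi p` is concave and
nondecreasing, the integrand is monotone, submodular and continuous from below in the set, so the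
risk is submodular and its sublevel sets are closed under monotone limits.

For an increasing sequence of such functionals, choose almost-minimizers with summable errors. A
union of consecutive ones remains almost minimal, because the intersection in the submodular
inequality costs at least the infimum. Hence the upper limit of the sequence lies below the supremum
of the infima for every functional (`exists_forall_le_iSup_infOverSets`). A constant sequence gives
existence for fixed `p`. The sequence `p = 1/(n+1)`, whose supremum is the functional of `psiZero`,
gives existence in the limit together with convergence of the minima.

At `psiZero` the three problems are sandwiched: the risk is at most the modified risk, which is at
most the adversarial risk. Conversely, every `A` can be replaced by a set `A'` whose adversarial
risk is at most the risk of `A` (`exists_advRisk_le_risk_psiZero`). So all three minima agree. -/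

/-- The union `A n ∪ A (n + 1) ∪ ⋯ ∪ A (n + k)`. -/
def segmentUnion {X : Type*} (A : ℕ → Set X) : ℕ → ℕ → Set X
  | n, 0 => A n
  | n, k + 1 => A n ∪ segmentUnion A (n + 1) k

theorem monotone_segmentUnion {X : Type*} (A : ℕ → Set X) (n : ℕ) : Monotone (segmentUnion A n) := by
  refine monotone_nat_of_le_succ fun k => ?_
  induction k generalizing n with
  | zero => exact subset_union_left
  | succ k ih => exact union_subset_union_right _ (ih (n + 1))

/-! ### Minimization of submodular set functionals. -/

section SetFunctional

variable {X : Type*} [MeasurableSpace X]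

/-- A finite submodular functional of measurable sets whose sublevel sets are closed under
monotone limits. -/
structure SubmodularLSC (F : Set X → ℝ≥0∞) : Prop where
  ne_top : ∀ A, MeasurableSet A → F A ≠ ∞
  submod : ∀ A B, MeasurableSet A → MeasurableSet B → F (A ∪ B) + F (A ∩ B) ≤ F A + F B
  iUnion_le : ∀ (A : ℕ → Set X) (c : ℝ≥0∞), (∀ n, MeasurableSet (A n)) → Monotone A →
    (∀ n, F (A n) ≤ c) → F (⋃ n, A n) ≤ c
  iInter_le : ∀ (A : ℕ → Set X) (c : ℝ≥0∞), (∀ n, MeasurableSet (A n)) → Antitone A →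
    (∀ n, F (A n) ≤ c) → F (⋂ n, A n) ≤ c

/-- The infimum of a functional over the measurable sets. -/
noncomputable def infOverSets (F : Set X → ℝ≥0∞) : ℝ≥0∞ :=
  ⨅ (A : Set X) (_ : MeasurableSet A), F A

theorem infOverSets_le (F : Set X → ℝ≥0∞) {A : Set X} (hA : MeasurableSet A) :
    infOverSets F ≤ F A :=
  iInf₂_le A hA

theorem infOverSets_mono {F G : Set X → ℝ≥0∞} (h : ∀ A, MeasurableSet A → F A ≤ G A) :
    infOverSets F ≤ infOverSets G :=
  iInf₂_mono h

theorem isMinOverSets_of_le_infOverSets {F : Set X → ℝ≥0∞} {A : Set X} (hA : MeasurableSet A)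
    (h : F A ≤ infOverSets F) : IsMinOverSets F (infOverSets F) := by
  refine ⟨⟨A, hA, le_antisymm h (infOverSets_le F hA)⟩, ?_⟩
  rintro _ ⟨B, hB, rfl⟩
  exact infOverSets_le F hB

theorem exists_le_infOverSets_add (F : Set X → ℝ≥0∞) (hF : F ∅ ≠ ∞) {δ : ℝ≥0∞} (hδ : δ ≠ 0) :
    ∃ A, MeasurableSet A ∧ F A ≤ infOverSets F + δ := by
  by_contra! h
  have h1 : infOverSets F + δ ≤ infOverSets F := le_iInf₂ fun A hA => (h A hA).le
  have h2 : infOverSets F ≠ ∞ :=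
    ne_top_of_le_ne_top hF (infOverSets_le F MeasurableSet.empty)
  exact absurd h1 (not_le.2 (ENNReal.lt_add_right h2 hδ))

theorem measurableSet_segmentUnion {A : ℕ → Set X} (hA : ∀ n, MeasurableSet (A n)) (n k : ℕ) :
    MeasurableSet (segmentUnion A n k) := by
  induction k generalizing n with
  | zero => exact hA n
  | succ k ih => exact (hA n).union (ih (n + 1))

/-- For an increasing sequence of submodular functionals, the upper limit of a sequence of fast
almost-minimizers is a set at which all functionals are below the supremum of the infima. -/
theorem exists_forall_le_iSup_infOverSets {F : ℕ → Set X → ℝ≥0∞}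
    (hF : ∀ n, SubmodularLSC (F n))
    (hmono : ∀ n A, MeasurableSet A → F n A ≤ F (n + 1) A) :
    ∃ A, MeasurableSet A ∧ ∀ n, F n A ≤ ⨆ k, infOverSets (F k) := by
  set s := ⨆ k, infOverSets (F k)
  have hle : ∀ n, infOverSets (F n) ≤ s := fun n => le_iSup (fun k => infOverSets (F k)) n
  have hpos : ∀ n : ℕ, (2⁻¹ : ℝ≥0∞) ^ n ≠ 0 := fun n => pow_ne_zero _ (by simp)
  -- The target error for unions starting at `n` is `2⁻ⁿ`: half is spent on `A n`, the other half on
  -- the union starting at `n + 1`.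
  choose A hA hAF using fun n => exists_le_infOverSets_add (F n)
    ((hF n).ne_top _ MeasurableSet.empty) (hpos (n + 1))
  have hhalf : ∀ n : ℕ, (2⁻¹ : ℝ≥0∞) ^ (n + 1) + 2⁻¹ ^ (n + 1) = 2⁻¹ ^ n := fun n => by
    rw [pow_succ, ← mul_add, ENNReal.inv_two_add_inv_two, mul_one]
  have hseg : ∀ k n, F n (segmentUnion A n k) ≤ s + 2⁻¹ ^ n := by
    intro k
    induction k with
    | zero =>
      intro n
      refine (hAF n).trans (add_le_add (hle n) ?_)
      rw [← hhalf n]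
      exact le_self_add
    | succ k ih =>
      intro n
      set C := segmentUnion A (n + 1) k
      have hC : MeasurableSet C := measurableSet_segmentUnion hA _ _
      have hfin : infOverSets (F n) ≠ ∞ :=
        ne_top_of_le_ne_top ((hF n).ne_top _ (hA n)) (infOverSets_le _ (hA n))
      -- `A n ∩ C` costs at least the infimum, which cancels against the cost of `A n`. The infimum
      -- is added on both sides to avoid truncated subtraction.
      have h1 : infOverSets (F n) + F n (A n ∪ C) ≤
          infOverSets (F n) + (2⁻¹ ^ (n + 1) + F n C) := calc
        _ ≤ F n (A n ∩ C) + F n (A n ∪ C) := by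
          gcongr
          exact infOverSets_le _ ((hA n).inter hC)
        _ = F n (A n ∪ C) + F n (A n ∩ C) := add_comm _ _
        _ ≤ F n (A n) + F n C := (hF n).submod _ _ (hA n) hC
        _ ≤ infOverSets (F n) + 2⁻¹ ^ (n + 1) + F n C := by
          gcongr
          exact hAF n
        _ = _ := add_assoc _ _ _
      calc F n (A n ∪ C) ≤ 2⁻¹ ^ (n + 1) + F n C := (ENNReal.add_le_add_iff_left hfin).1 h1
        _ ≤ 2⁻¹ ^ (n + 1) + (s + 2⁻¹ ^ (n + 1)) := by
          gcongr
          exact (hmono n C hC).trans (ih (n + 1))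
        _ = s + 2⁻¹ ^ n := by rw [← hhalf n]; ring
  have hmono' : ∀ {B : Set X}, MeasurableSet B → Monotone fun n => F n B :=
    fun hB => monotone_nat_of_le_succ fun n => hmono n _ hB
  set B : ℕ → Set X := fun n => ⋃ k, segmentUnion A n k with hB
  have hBmeas : ∀ n, MeasurableSet (B n) := fun n =>
    MeasurableSet.iUnion fun k => measurableSet_segmentUnion hA n k
  have hBanti : Antitone B := antitone_nat_of_succ_le fun n =>
    iUnion_subset fun k => subset_union_right.trans
      (subset_iUnion (fun k => segmentUnion A n k) (k + 1))
  have hBle : ∀ n, F n (B n) ≤ s + 2⁻¹ ^ n := fun n =>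
    (hF n).iUnion_le _ _ (fun k => measurableSet_segmentUnion hA n k)
      (monotone_segmentUnion A n) (fun k => hseg k n)
  refine ⟨⋂ n, B n, MeasurableSet.iInter hBmeas, fun j => ?_⟩
  have hlim : Tendsto (fun n : ℕ => s + (2⁻¹ : ℝ≥0∞) ^ n) atTop (𝓝 (s + 0)) :=
    tendsto_const_nhds.add (ENNReal.tendsto_pow_atTop_nhds_zero_of_lt_one (by simp))
  rw [add_zero] at hlim
  refine ge_of_tendsto hlim ?_
  filter_upwards [eventually_ge_atTop j] with n hn
  -- Dropping the first `n` sets leaves only sets whose error is at most `2⁻ⁿ`, and `F j ≤ F (i +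
  -- n)` since `j ≤ n`.
  have hshift : ⋂ i, B i = ⋂ i, B (i + n) := by
    refine subset_antisymm (subset_iInter fun i => iInter_subset _ _) ?_
    exact subset_iInter fun i => (iInter_subset _ i).trans (hBanti (Nat.le_add_right i n))
  rw [hshift]
  refine (hF j).iInter_le _ _ (fun i => hBmeas _) (fun a b hab => hBanti (by omega)) fun i => ?_
  calc F j (B (i + n)) ≤ F (i + n) (B (i + n)) := hmono' (hBmeas _) (by omega)
    _ ≤ s + 2⁻¹ ^ (i + n) := hBle _
    _ ≤ s + 2⁻¹ ^ n :=
      add_le_add le_rfl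
        (pow_le_pow_right_of_le_one' (ENNReal.inv_le_one.2 one_le_two) (by omega))

theorem SubmodularLSC.isMinOverSets {F : Set X → ℝ≥0∞} (hF : SubmodularLSC F) :
    IsMinOverSets F (infOverSets F) := by
  obtain ⟨A, hA, h⟩ := exists_forall_le_iSup_infOverSets (F := fun _ => F) (fun _ => hF)
    (fun _ _ _ => le_rfl)
  exact isMinOverSets_of_le_infOverSets hA (by simpa using h 0)

/-- Minimizers and minima of a family of submodular functionals that increases to `F₀` as the
parameter decreases to `0`. -/
theorem isMinOverSets_and_tendsto {F : ℝ → Set X → ℝ≥0∞} {F₀ : Set X → ℝ≥0∞}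
    (hF : ∀ p, 0 < p → SubmodularLSC (F p))
    (hanti : ∀ p p', 0 < p → p ≤ p' → ∀ A, MeasurableSet A → F p' A ≤ F p A)
    (hle : ∀ p, 0 < p → ∀ A, MeasurableSet A → F p A ≤ F₀ A)
    (hsup : ∀ A, MeasurableSet A → F₀ A ≤ ⨆ n : ℕ, F (1 / (n + 1)) A) :
    IsMinOverSets F₀ (infOverSets F₀) ∧
      (∀ p, 0 < p → IsMinOverSets (F p) (infOverSets (F p))) ∧
      Tendsto (fun p => infOverSets (F p)) (𝓝[>] 0) (𝓝 (infOverSets F₀)) := by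
  have hpos : ∀ n : ℕ, (0 : ℝ) < 1 / (n + 1) := fun n => by positivity
  obtain ⟨A, hA, h⟩ := exists_forall_le_iSup_infOverSets
    (F := fun n : ℕ => F (1 / ((n : ℝ) + 1))) (fun n => hF _ (hpos n))
    (fun n A hA => hanti _ _ (hpos _)
      (one_div_le_one_div_of_le (by positivity) (by push_cast; linarith)) A hA)
  -- One set does both jobs: `F₀ A ≤ sup inf F ≤ inf F₀` makes `A` a minimizer and leaves no gap in
  -- the limit.
  have hA0 : F₀ A ≤ ⨆ n : ℕ, infOverSets (F (1 / ((n : ℝ) + 1))) :=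
    (hsup A hA).trans (iSup_le h)
  have hinf : ∀ p, 0 < p → infOverSets (F p) ≤ infOverSets F₀ := fun p hp =>
    infOverSets_mono (hle p hp)
  refine ⟨isMinOverSets_of_le_infOverSets hA (hA0.trans (iSup_le fun n => hinf _ (hpos n))),
    fun p hp => (hF p hp).isMinOverSets, tendsto_order.2 ⟨fun c hc => ?_, fun c hc => ?_⟩⟩
  · obtain ⟨n, hn⟩ := lt_iSup_iff.1 (hc.trans_le ((infOverSets_le F₀ hA).trans hA0))
    filter_upwards [Ioo_mem_nhdsGT (hpos n)] with p hp
    exact hn.trans_le (infOverSets_mono (hanti _ _ hp.1 hp.2.le))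
  · filter_upwards [self_mem_nhdsWithin] with p hp
    exact (hinf p hp).trans_lt hc

end SetFunctional

/-! ### From integrands to two-sided functionals. -/

section Integrand

variable {X : Type*} [MeasurableSpace X]

/-- The functional that integrates `g x A` over `ρ₀` and `g x Aᶜ` over `ρ₁`. -/
noncomputable def twoSided (ρ₀ ρ₁ : Measure X) (g : X → Set X → ℝ≥0∞) (A : Set X) : ℝ≥0∞ :=
  (∫⁻ x, g x A ∂ρ₀) + ∫⁻ x, g x Aᶜ ∂ρ₁

/-- An integrand with values in `[0, 1]` that is monotone, submodular and continuous from below as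
a function of the set. -/
structure SubmodularIntegrand (ρ : Measure X) (g : X → Set X → ℝ≥0∞) : Prop where
  aemeasurable : ∀ A, MeasurableSet A → AEMeasurable (fun x => g x A) ρ
  le_one : ∀ x A, g x A ≤ 1
  mono : ∀ᵐ x ∂ρ, ∀ A B, A ⊆ B → g x A ≤ g x B
  submod : ∀ᵐ x ∂ρ, ∀ A B, MeasurableSet A → MeasurableSet B →
    g x (A ∪ B) + g x (A ∩ B) ≤ g x A + g x B
  iUnion_le : ∀ᵐ x ∂ρ, ∀ A : ℕ → Set X, (∀ n, MeasurableSet (A n)) → Monotone A →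
    g x (⋃ n, A n) ≤ ⨆ n, g x (A n)

theorem SubmodularIntegrand.of_absolutelyContinuous {ρ ρ' : Measure X} {g : X → Set X → ℝ≥0∞}
    (hg : SubmodularIntegrand ρ g) (h : ρ' ≪ ρ) : SubmodularIntegrand ρ' g :=
  ⟨fun A hA => (hg.aemeasurable A hA).mono_ac h, hg.le_one, h.ae_le hg.mono, h.ae_le hg.submod,
    h.ae_le hg.iUnion_le⟩

/-- This symmetry reduces decreasing intersections to increasing unions. -/
theorem twoSided_compl (ρ₀ ρ₁ : Measure X) (g : X → Set X → ℝ≥0∞) (A : Set X) :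
    twoSided ρ₀ ρ₁ g Aᶜ = twoSided ρ₁ ρ₀ g A := by
  rw [twoSided, twoSided, compl_compl, add_comm]

theorem twoSided_mono {ρ₀ ρ₁ : Measure X} {g g' : X → Set X → ℝ≥0∞} {A : Set X}
    (h₀ : ∀ᵐ x ∂ρ₀, g x A ≤ g' x A) (h₁ : ∀ᵐ x ∂ρ₁, g x Aᶜ ≤ g' x Aᶜ) :
    twoSided ρ₀ ρ₁ g A ≤ twoSided ρ₀ ρ₁ g' A :=
  add_le_add (lintegral_mono_ae h₀) (lintegral_mono_ae h₁)

/-- The label-0 term passes to the limit by monotone convergence. In the label-1 term the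
complements shrink, so monotonicity alone suffices and continuity from above is never needed. -/
theorem twoSided_iUnion_le {ρ₀ ρ₁ : Measure X} {g : X → Set X → ℝ≥0∞}
    (h₀ : SubmodularIntegrand ρ₀ g) (h₁ : SubmodularIntegrand ρ₁ g) {A : ℕ → Set X} {c : ℝ≥0∞}
    (hA : ∀ n, MeasurableSet (A n)) (hmono : Monotone A)
    (hc : ∀ n, twoSided ρ₀ ρ₁ g (A n) ≤ c) : twoSided ρ₀ ρ₁ g (⋃ n, A n) ≤ c := by
  have h : ∫⁻ x, g x (⋃ n, A n) ∂ρ₀ ≤ ⨆ n, ∫⁻ x, g x (A n) ∂ρ₀ := by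
    rw [← lintegral_iSup' (fun n => h₀.aemeasurable _ (hA n))]
    · refine lintegral_mono_ae ?_
      filter_upwards [h₀.iUnion_le] with x hx using hx A hA hmono
    · filter_upwards [h₀.mono] with x hx a b hab using hx _ _ (hmono hab)
  calc twoSided ρ₀ ρ₁ g (⋃ n, A n)
      ≤ (⨆ n, ∫⁻ x, g x (A n) ∂ρ₀) + ∫⁻ x, g x (⋃ n, A n)ᶜ ∂ρ₁ := by
        rw [twoSided]; gcongr
    _ = ⨆ n, ((∫⁻ x, g x (A n) ∂ρ₀) + ∫⁻ x, g x (⋃ n, A n)ᶜ ∂ρ₁) := ENNReal.iSup_add _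
    _ ≤ c := iSup_le fun n => by
        refine le_trans ?_ (hc n)
        rw [twoSided]
        refine add_le_add le_rfl (lintegral_mono_ae ?_)
        filter_upwards [h₁.mono] with x hx
        exact hx _ _ (compl_subset_compl.2 (subset_iUnion A n))

theorem SubmodularIntegrand.submodularLSC {ρ₀ ρ₁ : Measure X} [IsFiniteMeasure ρ₀]
    [IsFiniteMeasure ρ₁] {g : X → Set X → ℝ≥0∞} (h₀ : SubmodularIntegrand ρ₀ g)
    (h₁ : SubmodularIntegrand ρ₁ g) : SubmodularLSC (twoSided ρ₀ ρ₁ g) where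
  ne_top A _ := by
    have key : ∀ (ρ : Measure X) [IsFiniteMeasure ρ] (B : Set X), ∫⁻ x, g x B ∂ρ ≠ ∞ :=
      fun ρ _ B => ne_top_of_le_ne_top (measure_ne_top ρ univ)
        ((lintegral_mono fun x => h₀.le_one x B).trans (by simp))
    exact ENNReal.add_ne_top.2 ⟨key _ _, key _ _⟩
  submod A B hA hB := by
    have key : ∀ (ρ : Measure X), SubmodularIntegrand ρ g → ∀ A B : Set X, MeasurableSet A →
        MeasurableSet B → (∫⁻ x, g x (A ∪ B) ∂ρ) + ∫⁻ x, g x (A ∩ B) ∂ρ ≤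
          (∫⁻ x, g x A ∂ρ) + ∫⁻ x, g x B ∂ρ := by
      intro ρ h A B hA hB
      rw [← lintegral_add_left' (h.aemeasurable _ (hA.union hB)),
        ← lintegral_add_left' (h.aemeasurable _ hA)]
      refine lintegral_mono_ae ?_
      filter_upwards [h.submod] with x hx using hx A B hA hB
    have k₀ := key ρ₀ h₀ A B hA hB
    have k₁ := key ρ₁ h₁ Aᶜ Bᶜ hA.compl hB.compl
    rw [← compl_inter, ← compl_union] at k₁
    simp only [twoSided]
    calc _ = ((∫⁻ x, g x (A ∪ B) ∂ρ₀) + ∫⁻ x, g x (A ∩ B) ∂ρ₀) +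
          ((∫⁻ x, g x (A ∩ B)ᶜ ∂ρ₁) + ∫⁻ x, g x (A ∪ B)ᶜ ∂ρ₁) := by ring
      _ ≤ _ := add_le_add k₀ k₁
      _ = _ := by ring
  iUnion_le A c hA hmono hc := twoSided_iUnion_le h₀ h₁ hA hmono hc
  iInter_le A c hA hanti hc := by
    rw [← twoSided_compl, compl_iInter]
    refine twoSided_iUnion_le h₁ h₀ (fun n => (hA n).compl)
      (fun a b hab => compl_subset_compl.2 (hanti hab)) fun n => ?_
    rw [twoSided_compl]
    exact hc n

theorem twoSided_le_iSup {ρ₀ ρ₁ : Measure X} {G : ℕ → X → Set X → ℝ≥0∞} {g : X → Set X → ℝ≥0∞}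
    (h₀ : ∀ n, SubmodularIntegrand ρ₀ (G n)) (h₁ : ∀ n, SubmodularIntegrand ρ₁ (G n))
    (hmono : ∀ x A, Monotone fun n => G n x A) (hsup : ∀ x A, g x A ≤ ⨆ n, G n x A)
    {A : Set X} (hA : MeasurableSet A) :
    twoSided ρ₀ ρ₁ g A ≤ ⨆ n, twoSided ρ₀ ρ₁ (G n) A := by
  have key : ∀ (ρ : Measure X), (∀ n, SubmodularIntegrand ρ (G n)) → ∀ A, MeasurableSet A →
      ∫⁻ x, g x A ∂ρ ≤ ⨆ n, ∫⁻ x, G n x A ∂ρ := by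
    intro ρ h A hA
    rw [← lintegral_iSup' (fun n => (h n).aemeasurable A hA)
      (Eventually.of_forall fun x => hmono x A)]
    exact lintegral_mono fun x => hsup x A
  refine (add_le_add (key ρ₀ h₀ A hA) (key ρ₁ h₁ _ hA.compl)).trans_eq ?_
  exact ENNReal.iSup_add_iSup_of_monotone
    (fun a b hab => lintegral_mono fun x => hmono x A hab)
    (fun a b hab => lintegral_mono fun x => hmono x Aᶜ hab)

end Integrand

/-! ### The functions `psi p` and `psiZero`. -/

section Psi

theorem psi_nonneg {p t : ℝ} (hp : 0 < p) (ht : 0 ≤ t) : 0 ≤ psi p t :=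
  le_min (by positivity) zero_le_one

theorem psi_mono {p : ℝ} (hp : 0 < p) : Monotone (psi p) := fun _ _ h =>
  min_le_min_right _ (div_le_div_of_nonneg_right h hp.le)

theorem psi_anti {p p' t : ℝ} (hp : 0 < p) (h : p ≤ p') (ht : 0 ≤ t) : psi p' t ≤ psi p t :=
  min_le_min_right _ (div_le_div_of_nonneg_left ht hp h)

theorem continuous_psi (p : ℝ) : Continuous (psi p) := by
  unfold psi; fun_prop

theorem psi_le_psiZero {p t : ℝ} (ht : 0 ≤ t) : psi p t ≤ psiZero t := by
  rcases ht.eq_or_lt with rfl | h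
  · simp [psi, psiZero]
  · simp [psi, psiZero, h]

theorem psiZero_le_one (t : ℝ) : psiZero t ≤ 1 :=
  indicator_le_self' (f := fun _ => (1 : ℝ)) (fun _ _ => zero_le_one) t

/-- This is concavity: `b` and `c` lie between `a` and `d` and have the same sum, so spreading them
out to `a` and `d` cannot increase the total. -/
theorem psi_submod {p a b c d : ℝ} (hp : 0 < p) (h : d + a = b + c) (hab : a ≤ b) (hac : a ≤ c) :
    psi p d + psi p a ≤ psi p b + psi p c := by
  have h1 : d / p + a / p = b / p + c / p := by rw [← add_div, ← add_div, h]
  have h2 : a / p ≤ b / p := div_le_div_of_nonneg_right hab hp.le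
  have h3 : a / p ≤ c / p := div_le_div_of_nonneg_right hac hp.le
  simp only [psi]
  rcases min_cases (b / p) 1 with ⟨e, _⟩ | ⟨e, _⟩ <;>
    rcases min_cases (c / p) 1 with ⟨e', _⟩ | ⟨e', _⟩ <;> rw [e, e'] <;>
    linarith [min_le_left (d / p) 1, min_le_right (d / p) 1, min_le_left (a / p) 1,
      min_le_right (a / p) 1]

/-- At a point `t > 0` the supremum is already attained once `1/(n+1) < t`. -/
theorem psiZero_le_iSup_psi {t : ℝ} (ht : 0 ≤ t) :
    ENNReal.ofReal (psiZero t) ≤ ⨆ n : ℕ, ENNReal.ofReal (psi (1 / ((n : ℝ) + 1)) t) := by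
  rcases ht.eq_or_lt with rfl | h
  · simp [psiZero]
  · obtain ⟨n, hn⟩ := exists_nat_one_div_lt h
    refine le_iSup_of_le n (ENNReal.ofReal_le_ofReal ?_)
    refine (psiZero_le_one t).trans (le_min ?_ le_rfl)
    rw [le_div_iff₀ (by positivity)]
    linarith

end Psi

/-! ### The two risks as two-sided functionals. -/

section Risk

variable {X : Type*} [MeasurableSpace X]

/-- The integrand of `risk`. -/
noncomputable def riskIntegrand (Ψ : ℝ → ℝ) (m : X → Measure X) (x : X) (A : Set X) : ℝ≥0∞ :=
  ENNReal.ofReal (Ψ ((m x).real A))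

open Classical in
/-- The integrand of `probRisk`. -/
noncomputable def probRiskIntegrand (Ψ : ℝ → ℝ) (m : X → Measure X) (x : X) (A : Set X) :
    ℝ≥0∞ :=
  if x ∈ A then 1 else riskIntegrand Ψ m x A

theorem riskIntegrand_le_one {Ψ : ℝ → ℝ} (hΨ : ∀ t, Ψ t ≤ 1) (m : X → Measure X) (x : X)
    (A : Set X) : riskIntegrand Ψ m x A ≤ 1 :=
  ENNReal.ofReal_le_one.2 (hΨ _)

theorem probRiskIntegrand_le_one {Ψ : ℝ → ℝ} (hΨ : ∀ t, Ψ t ≤ 1) (m : X → Measure X) (x : X)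
    (A : Set X) : probRiskIntegrand Ψ m x A ≤ 1 := by
  unfold probRiskIntegrand
  split_ifs
  exacts [le_rfl, riskIntegrand_le_one hΨ m x A]

theorem riskIntegrand_le_probRiskIntegrand {Ψ : ℝ → ℝ} (hΨ : ∀ t, Ψ t ≤ 1) (m : X → Measure X)
    (x : X) (A : Set X) : riskIntegrand Ψ m x A ≤ probRiskIntegrand Ψ m x A := by
  unfold probRiskIntegrand
  split_ifs
  exacts [riskIntegrand_le_one hΨ m x A, le_rfl]

theorem probRiskIntegrand_mono {Ψ Ψ' : ℝ → ℝ} {m : X → Measure X} {x : X} {A : Set X}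
    (h : riskIntegrand Ψ m x A ≤ riskIntegrand Ψ' m x A) :
    probRiskIntegrand Ψ m x A ≤ probRiskIntegrand Ψ' m x A := by
  unfold probRiskIntegrand
  split_ifs
  exacts [le_rfl, h]

theorem aemeasurable_real {ρ : Measure X} {m : X → Measure X} (hm : AEMeasurable m ρ) {A : Set X}
    (hA : MeasurableSet A) : AEMeasurable (fun x => (m x).real A) ρ :=
  ((Measure.measurable_coe hA).comp_aemeasurable hm).ennreal_toReal

theorem submodularIntegrand_risk {ρ : Measure X} {m : X → Measure X} (hm : AEMeasurable m ρ)
    (hprob : ∀ᵐ x ∂ρ, IsProbabilityMeasure (m x)) {p : ℝ} (hp : 0 < p) :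
    SubmodularIntegrand ρ (riskIntegrand (psi p) m) where
  aemeasurable A hA :=
    ((continuous_psi p).measurable.comp_aemeasurable (aemeasurable_real hm hA)).ennreal_ofReal
  le_one x A := riskIntegrand_le_one (fun _ => min_le_right _ _) m x A
  mono := by
    filter_upwards [hprob] with x hx A B hAB
    exact ENNReal.ofReal_le_ofReal (psi_mono hp (measureReal_mono hAB))
  submod := by
    filter_upwards [hprob] with x hx A B hA hB
    simp only [riskIntegrand]
    rw [← ENNReal.ofReal_add (psi_nonneg hp measureReal_nonneg)
        (psi_nonneg hp measureReal_nonneg),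
      ← ENNReal.ofReal_add (psi_nonneg hp measureReal_nonneg) (psi_nonneg hp measureReal_nonneg)]
    exact ENNReal.ofReal_le_ofReal (psi_submod hp (measureReal_union_add_inter hB)
      (measureReal_mono inter_subset_left) (measureReal_mono inter_subset_right))
  iUnion_le := by
    filter_upwards [hprob] with x hx A hA hmono
    have h1 : Tendsto (fun n => (m x).real (A n)) atTop (𝓝 ((m x).real (⋃ n, A n))) :=
      (ENNReal.tendsto_toReal (measure_ne_top _ _)).comp (tendsto_measure_iUnion_atTop hmono)
    have h2 := ENNReal.tendsto_ofReal (((continuous_psi p).tendsto _).comp h1)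
    exact le_of_tendsto h2 (Eventually.of_forall fun n =>
      le_iSup (fun n => riskIntegrand (psi p) m x (A n)) n)

/-- Raising the integrand to its upper bound 1 when `x ∈ A` is harmless: if `x` lies in just one of
two sets, their union and that set both contribute 1, and monotonicity compares the intersection
with the other set. -/
theorem SubmodularIntegrand.probRisk {ρ : Measure X} {m : X → Measure X} {Ψ : ℝ → ℝ}
    (hΨ : ∀ t, Ψ t ≤ 1) (h : SubmodularIntegrand ρ (riskIntegrand Ψ m)) :
    SubmodularIntegrand ρ (probRiskIntegrand Ψ m) where
  aemeasurable A hA := by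
    obtain ⟨f, hf, hfg⟩ := h.aemeasurable A hA
    classical
    refine ⟨fun x => if x ∈ A then 1 else f x, Measurable.ite hA measurable_const hf, ?_⟩
    filter_upwards [hfg] with x hx
    simp [probRiskIntegrand, hx]
  le_one := probRiskIntegrand_le_one hΨ m
  mono := by
    filter_upwards [h.mono] with x hx A B hAB
    by_cases hB : x ∈ B
    · rw [probRiskIntegrand.eq_1 Ψ m x B, if_pos hB]
      exact probRiskIntegrand_le_one hΨ m x A
    · have hA : x ∉ A := fun hA => hB (hAB hA)
      simpa [probRiskIntegrand, hA, hB] using hx A B hAB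
  submod := by
    filter_upwards [h.submod, h.mono] with x hx hmono A B hA hB
    by_cases h1 : x ∈ A <;> by_cases h2 : x ∈ B <;> simp only [probRiskIntegrand, mem_union,
      mem_inter_iff, h1, h2, or_true, and_self, and_true, or_self, or_false, and_false, if_true,
      if_false, le_refl]
    · gcongr
      exact hmono _ _ inter_subset_right
    · rw [add_comm]
      gcongr
      exact hmono _ _ inter_subset_left
    · exact hx A B hA hB
  iUnion_le := by
    filter_upwards [h.iUnion_le] with x hx A hA hmono
    by_cases hx' : x ∈ ⋃ n, A n
    · obtain ⟨n, hn⟩ := mem_iUnion.1 hx'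
      refine (probRiskIntegrand_le_one hΨ m x _).trans (le_iSup_of_le n ?_)
      rw [probRiskIntegrand, if_pos hn]
    · rw [probRiskIntegrand, if_neg hx']
      exact (hx A hA hmono).trans
        (iSup_mono fun n => riskIntegrand_le_probRiskIntegrand hΨ m x (A n))

/-- Finiteness matters because `Measure.real` sends infinite mass to 0. -/
theorem one_le_riskIntegrand_psiZero {m : X → Measure X} {x : X} [IsFiniteMeasure (m x)]
    {A : Set X} (h : m x A ≠ 0) : 1 ≤ riskIntegrand psiZero m x A := by
  have : 0 < (m x).real A := ENNReal.toReal_pos h (measure_ne_top _ _)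
  simp [riskIntegrand, psiZero, this]

theorem isFiniteMeasure_labelMeasure (μ : Measure (X × Fin 2)) [IsProbabilityMeasure μ]
    (i : Fin 2) : IsFiniteMeasure (labelMeasure μ i) := by
  unfold labelMeasure; infer_instance

theorem labelMeasure_absolutelyContinuous (μ : Measure (X × Fin 2)) (i : Fin 2) :
    labelMeasure μ i ≪ dataMeasure μ :=
  (Measure.restrict_le_self.absolutelyContinuous).map measurable_fst

theorem lintegral_label (μ : Measure (X × Fin 2)) {f h : X → ℝ≥0∞} (hf : Measurable f)
    (hh : Measurable h) :
    ∫⁻ z, (if z.2 = 1 then f z.1 else h z.1) ∂μ =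
      (∫⁻ x, h x ∂(labelMeasure μ 0)) + ∫⁻ x, f x ∂(labelMeasure μ 1) := by
  have hs : ∀ i : Fin 2, MeasurableSet {z : X × Fin 2 | z.2 = i} := fun i =>
    measurable_snd (measurableSet_singleton i)
  have hc : {z : X × Fin 2 | z.2 = 0}ᶜ = {z | z.2 = 1} := by
    ext z
    simp only [mem_compl_iff, mem_ofPred_eq]
    omega
  rw [labelMeasure, labelMeasure, lintegral_map hh measurable_fst, lintegral_map hf measurable_fst,
    ← lintegral_add_compl _ (hs 0), hc]
  congr 1
  · refine setLIntegral_congr_fun (hs 0) fun z hz => ?_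
    have : z.2 = 0 := hz
    simp [this]
  · refine setLIntegral_congr_fun (hs 1) fun z hz => ?_
    have : z.2 = 1 := hz
    simp [this]

theorem risk_eq_twoSided (Ψ : ℝ → ℝ) (m : X → Measure X) (μ : Measure (X × Fin 2)) :
    risk Ψ m μ = twoSided (labelMeasure μ 0) (labelMeasure μ 1) (riskIntegrand Ψ m) := rfl

/-- The standard risk supplies the value 1 on `A` (label 0) and on `Aᶜ` (label 1), exactly where the
perimeter does not integrate. -/
theorem probRisk_eq_twoSided (Ψ : ℝ → ℝ) (m : X → Measure X) (μ : Measure (X × Fin 2))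
    {A : Set X} (hA : MeasurableSet A) :
    probRisk Ψ m μ A =
      twoSided (labelMeasure μ 0) (labelMeasure μ 1) (probRiskIntegrand Ψ m) A := by
  have key : ∀ (ρ : Measure X) (B : Set X), MeasurableSet B →
      ∫⁻ x, probRiskIntegrand Ψ m x B ∂ρ =
        (∫⁻ x, B.indicator 1 x ∂ρ) + ∫⁻ x in Bᶜ, ENNReal.ofReal (Ψ ((m x).real B)) ∂ρ := by
    intro ρ B hB
    rw [← lintegral_add_compl _ hB, lintegral_indicator hB]
    congr 1
    · exact setLIntegral_congr_fun hB fun x hx => by simp [probRiskIntegrand, hx]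
    · refine setLIntegral_congr_fun hB.compl fun x hx => ?_
      rw [mem_compl_iff] at hx
      simp [probRiskIntegrand, hx, riskIntegrand]
  rw [twoSided, key _ _ hA, key _ _ hA.compl, compl_compl, probRisk, stdRisk, probPer,
    lintegral_label μ (measurable_one.indicator hA.compl) (measurable_one.indicator hA)]
  ring

end Risk

/-! ### Comparison with the adversarial risk. -/

section Adversarial

/-- A point outside the fattening of `A` has a ball disjoint from `A`, and that ball carries all of
`m x`. -/
theorem probRiskIntegrand_psiZero_le {X : Type*} [MetricSpace X] [MeasurableSpace X]
    {m : X → Measure X} {ε : ℝ} (hε : 0 < ε) {x : X}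
    (hx : m x (Metric.ball x ε)ᶜ = 0) (A : Set X) :
    probRiskIntegrand psiZero m x A ≤ (Metric.thickening ε A).indicator 1 x := by
  by_cases h : x ∈ Metric.thickening ε A
  · rw [indicator_of_mem h]
    exact probRiskIntegrand_le_one psiZero_le_one m x A
  · have hxA : x ∉ A := fun hxA => h (Metric.self_subset_thickening hε A hxA)
    have hsub : A ⊆ (Metric.ball x ε)ᶜ := fun y hy hyb => h <| by
      rw [Metric.mem_thickening_iff]
      exact ⟨y, hy, Metric.mem_ball'.1 hyb⟩
    have h0 : (m x).real A = 0 := by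
      rw [measureReal_def, measure_mono_null hsub hx, ENNReal.toReal_zero]
    simp [probRiskIntegrand, hxA, riskIntegrand, h0, psiZero]

variable {X : Type*} [MetricSpace X] [MeasurableSpace X] [BorelSpace X]

theorem advRisk_eq_twoSided (ε : ℝ) (μ : Measure (X × Fin 2)) :
    advRisk ε μ = twoSided (labelMeasure μ 0) (labelMeasure μ 1)
      (fun x A => (Metric.thickening ε A).indicator 1 x) := by
  funext A
  exact lintegral_label μ (measurable_one.indicator Metric.isOpen_thickening.measurableSet)
    (measurable_one.indicator Metric.isOpen_thickening.measurableSet)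

/-- Two balls whose perturbation distributions see `A`, respectively `Aᶜ`, as a null set are
disjoint. -/
theorem disjoint_balls_of_null {m : X → Measure X} {ε : ℝ} {x x' : X} {A : Set X}
    (hsupp : Metric.ball x ε ⊆ (m x).support)
    (hac : (m x).restrict (Metric.ball x' ε) ≪ m x')
    (hx : m x A = 0) (hx' : m x' Aᶜ = 0) :
    Disjoint (Metric.ball x ε) (Metric.ball x' ε) := by
  rw [Set.disjoint_left]
  intro y hy hy'
  have hU : Metric.ball x ε ∩ Metric.ball x' ε ∈ 𝓝 y :=
    inter_mem (Metric.isOpen_ball.mem_nhds hy) (Metric.isOpen_ball.mem_nhds hy')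
  -- A common point `y` is in the support of `m x`, so the overlap of the balls has positive mass.
  -- Yet its part in `A` is null by `hx`, and its part in `Aᶜ` is null by absolute continuity.
  refine ((Measure.mem_support_iff_forall y).1 (hsupp hy) _ hU).ne' ?_
  have h1 : m x (Aᶜ ∩ Metric.ball x' ε) = 0 := by
    rw [← Measure.restrict_apply' Metric.isOpen_ball.measurableSet]
    exact hac hx'
  refine measure_mono_null (fun z hz => ?_) (measure_union_null hx h1)
  by_cases hzA : z ∈ A
  exacts [Or.inl hzA, Or.inr ⟨hzA, hz.2⟩]

/-- The new set is the fattening of the support points whose perturbations almost surely land in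
`A`. It is open, so no measurability of `A` or of these points is needed. -/
theorem exists_advRisk_le_risk_psiZero (μ : Measure (X × Fin 2)) (m : X → Measure X) (ε : ℝ)
    (hm_prob : ∀ᵐ x ∂(dataMeasure μ), IsProbabilityMeasure (m x))
    (hρ : dataMeasure μ (dataMeasure μ).supportᶜ = 0)
    (h_supp : ∀ x ∈ (dataMeasure μ).support, Metric.ball x ε ⊆ (m x).support)
    (h_ac : ∀ x ∈ (dataMeasure μ).support,
      ∀ x' ∈ (dataMeasure μ).support, (m x').restrict (Metric.ball x ε) ≪ m x)
    (A : Set X) : ∃ A', MeasurableSet A' ∧ advRisk ε μ A' ≤ risk psiZero m μ A := by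
  set D : Set X := {x | x ∈ (dataMeasure μ).support ∧ m x Aᶜ = 0} with hD
  have hS : ∀ᵐ x ∂(dataMeasure μ), x ∈ (dataMeasure μ).support := hρ
  refine ⟨Metric.thickening ε D, Metric.isOpen_thickening.measurableSet, ?_⟩
  rw [advRisk_eq_twoSided, risk_eq_twoSided]
  refine add_le_add (lintegral_mono_ae ?_) (lintegral_mono_ae ?_)
  -- Label 0: if `m x A = 0`, the ball of `x` is disjoint from the ball of every point of `D`, so
  -- `x` is not attacked.
  · filter_upwards [(labelMeasure_absolutelyContinuous μ 0).ae_le hS,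
      (labelMeasure_absolutelyContinuous μ 0).ae_le hm_prob] with x hxS hxp
    refine indicator_apply_le' (fun hx => ?_) (fun _ => zero_le)
    refine one_le_riskIntegrand_psiZero fun h0 => ?_
    obtain ⟨y, hy, hxy⟩ := Metric.mem_thickening_iff.1 hx
    obtain ⟨x', hx', hyx'⟩ := Metric.mem_thickening_iff.1 hy
    exact Set.disjoint_left.1 (disjoint_balls_of_null (h_supp x hxS) (h_ac x' hx'.1 x hxS) h0 hx'.2)
      (Metric.mem_ball'.2 hxy) (Metric.mem_ball.2 hyx')
  -- Label 1: if `m x Aᶜ = 0`, then `x ∈ D`, so its whole ball lies in the new set.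
  · filter_upwards [(labelMeasure_absolutelyContinuous μ 1).ae_le hS,
      (labelMeasure_absolutelyContinuous μ 1).ae_le hm_prob] with x hxS hxp
    refine indicator_apply_le' (fun hx => ?_) (fun _ => zero_le)
    refine one_le_riskIntegrand_psiZero fun h0 => ?_
    obtain ⟨y, hy, hxy⟩ := Metric.mem_thickening_iff.1 hx
    refine hy (Metric.mem_thickening_iff.2 ⟨x, ⟨hxS, h0⟩, ?_⟩)
    rwa [dist_comm]

end Adversarial

/-! ### Transfer of minima and the main theorem. -/

theorem IsMinOverSets.transfer {X : Type*} [MeasurableSpace X] {F G : Set X → ℝ≥0∞} {a : ℝ≥0∞}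
    (h : IsMinOverSets F a) (hFG : ∀ A, MeasurableSet A → F A ≤ G A)
    (hGF : ∀ A, MeasurableSet A → ∃ A', MeasurableSet A' ∧ G A' ≤ F A) : IsMinOverSets G a := by
  obtain ⟨⟨A, hA, rfl⟩, hmin⟩ := h
  have hlow : ∀ B, MeasurableSet B → F A ≤ G B := fun B hB =>
    (hmin ⟨B, hB, rfl⟩).trans (hFG B hB)
  obtain ⟨A', hA', hle⟩ := hGF A hA
  refine ⟨⟨A', hA', le_antisymm hle (hlow A' hA')⟩, ?_⟩
  rintro _ ⟨B, hB, rfl⟩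
  exact hlow B hB

theorem IsMinOverSets.unique {X : Type*} [MeasurableSpace X] {F : Set X → ℝ≥0∞} {a b : ℝ≥0∞}
    (ha : IsMinOverSets F a) (hb : IsMinOverSets F b) : a = b :=
  IsLeast.unique ha hb

theorem isMinOverSets_congr {X : Type*} [MeasurableSpace X] {F G : Set X → ℝ≥0∞} {a : ℝ≥0∞}
    (h : ∀ A, MeasurableSet A → F A = G A) : IsMinOverSets F a ↔ IsMinOverSets G a := by
  unfold IsMinOverSets
  rw [image_congr (f := F) (g := G) (s := {A | MeasurableSet A}) h]

end ProbRobust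

open ProbRobust

theorem mainTheorem7 {X : Type*} [MetricSpace X] [MeasurableSpace X] [BorelSpace X]
    (μ : Measure (X × Fin 2)) [IsProbabilityMeasure μ]
    (m : X → Measure X) (ε : ℝ) (hε : 0 < ε)
    -- the perturbation distributions: a measurable family of probability measures, up to null sets
    (hm_meas : AEMeasurable m (ProbRobust.dataMeasure μ))
    (hm_prob : ∀ᵐ x ∂(ProbRobust.dataMeasure μ), IsProbabilityMeasure (m x))
    -- the data distribution is carried by its support (automatic if `X` is separable)
    (hρ : ProbRobust.dataMeasure μ (ProbRobust.dataMeasure μ).supportᶜ = 0)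
    (h_ball : ∀ x ∈ (ProbRobust.dataMeasure μ).support, m x (Metric.ball x ε)ᶜ = 0)
    (h_supp : ∀ x ∈ (ProbRobust.dataMeasure μ).support, Metric.ball x ε ⊆ (m x).support)
    (h_ac : ∀ x ∈ (ProbRobust.dataMeasure μ).support,
      ∀ x' ∈ (ProbRobust.dataMeasure μ).support, (m x').restrict (Metric.ball x ε) ≪ m x) :
    ∃ (a : ℝ≥0∞) (r q : ℝ → ℝ≥0∞),
      ProbRobust.IsMinOverSets (ProbRobust.advRisk ε μ) a ∧
      ProbRobust.IsMinOverSets (ProbRobust.risk ProbRobust.psiZero m μ) a ∧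
      ProbRobust.IsMinOverSets (ProbRobust.probRisk ProbRobust.psiZero m μ) a ∧
      (∀ p : ℝ, 0 < p → ProbRobust.IsMinOverSets (ProbRobust.risk (ProbRobust.psi p) m μ) (r p)) ∧
      Tendsto r (𝓝[>] 0) (𝓝 a) ∧
      (∀ p : ℝ, 0 < p →
        ProbRobust.IsMinOverSets (ProbRobust.probRisk (ProbRobust.psi p) m μ) (q p)) ∧
      Tendsto q (𝓝[>] 0) (𝓝 a) := by
  set ρ₀ := labelMeasure μ 0
  set ρ₁ := labelMeasure μ 1
  have hac₀ : ρ₀ ≪ dataMeasure μ := labelMeasure_absolutelyContinuous μ 0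
  have hac₁ : ρ₁ ≪ dataMeasure μ := labelMeasure_absolutelyContinuous μ 1
  have : IsFiniteMeasure ρ₀ := isFiniteMeasure_labelMeasure μ 0
  have : IsFiniteMeasure ρ₁ := isFiniteMeasure_labelMeasure μ 1
  have hpos : ∀ n : ℕ, (0 : ℝ) < 1 / (n + 1) := fun n => by positivity
  have hstep : ∀ i j : ℕ, i ≤ j → (1 : ℝ) / (j + 1) ≤ 1 / (i + 1) := fun i j h =>
    one_div_le_one_div_of_le (by positivity) (by
      have : (i : ℝ) ≤ j := by exact_mod_cast h
      linarith)
  have hpsi1 : ∀ p t, psi p t ≤ 1 := fun _ _ => min_le_right _ _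
  have hRanti : ∀ p p', 0 < p → p ≤ p' → ∀ x A,
      riskIntegrand (psi p') m x A ≤ riskIntegrand (psi p) m x A := fun p p' hp h x A =>
    ENNReal.ofReal_le_ofReal (psi_anti hp h measureReal_nonneg)
  have hRle : ∀ p x A, riskIntegrand (psi p) m x A ≤ riskIntegrand psiZero m x A := fun p x A =>
    ENNReal.ofReal_le_ofReal (psi_le_psiZero measureReal_nonneg)
  have hRsup : ∀ x A, riskIntegrand psiZero m x A ≤
      ⨆ n : ℕ, riskIntegrand (psi (1 / ((n : ℝ) + 1))) m x A := fun x A =>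
    psiZero_le_iSup_psi measureReal_nonneg
  have hR : ∀ p, 0 < p → SubmodularIntegrand (dataMeasure μ) (riskIntegrand (psi p) m) :=
    fun p hp => submodularIntegrand_risk hm_meas hm_prob hp
  have hP : ∀ p, 0 < p → SubmodularIntegrand (dataMeasure μ) (probRiskIntegrand (psi p) m) :=
    fun p hp => (hR p hp).probRisk (hpsi1 p)
  obtain ⟨hR0, hRp, hRlim⟩ := isMinOverSets_and_tendsto
    (F := fun p => twoSided ρ₀ ρ₁ (riskIntegrand (psi p) m))
    (F₀ := twoSided ρ₀ ρ₁ (riskIntegrand psiZero m))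
    (fun p hp => ((hR p hp).of_absolutelyContinuous hac₀).submodularLSC
      ((hR p hp).of_absolutelyContinuous hac₁))
    (fun p p' hp h A _ => twoSided_mono (Eventually.of_forall fun x => hRanti p p' hp h x A)
      (Eventually.of_forall fun x => hRanti p p' hp h x Aᶜ))
    (fun p _ A _ => twoSided_mono (Eventually.of_forall fun x => hRle p x A)
      (Eventually.of_forall fun x => hRle p x Aᶜ))
    (fun A hA => twoSided_le_iSup
      (fun n => (hR _ (hpos n)).of_absolutelyContinuous hac₀)
      (fun n => (hR _ (hpos n)).of_absolutelyContinuous hac₁)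
      (fun x A i j hij => hRanti _ _ (hpos j) (hstep i j hij) x A) hRsup hA)
  obtain ⟨hP0, hPp, hPlim⟩ := isMinOverSets_and_tendsto
    (F := fun p => twoSided ρ₀ ρ₁ (probRiskIntegrand (psi p) m))
    (F₀ := twoSided ρ₀ ρ₁ (probRiskIntegrand psiZero m))
    (fun p hp => ((hP p hp).of_absolutelyContinuous hac₀).submodularLSC
      ((hP p hp).of_absolutelyContinuous hac₁))
    (fun p p' hp h A _ => twoSided_mono
      (Eventually.of_forall fun x => probRiskIntegrand_mono (hRanti p p' hp h x A))
      (Eventually.of_forall fun x => probRiskIntegrand_mono (hRanti p p' hp h x Aᶜ)))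
    (fun p _ A _ => twoSided_mono
      (Eventually.of_forall fun x => probRiskIntegrand_mono (hRle p x A))
      (Eventually.of_forall fun x => probRiskIntegrand_mono (hRle p x Aᶜ)))
    (fun A hA => twoSided_le_iSup
      (fun n => (hP _ (hpos n)).of_absolutelyContinuous hac₀)
      (fun n => (hP _ (hpos n)).of_absolutelyContinuous hac₁)
      (fun x A i j hij => probRiskIntegrand_mono (hRanti _ _ (hpos j) (hstep i j hij) x A))
      (fun x A => by
        by_cases hx : x ∈ A
        · simp [probRiskIntegrand, hx]
        · simpa [probRiskIntegrand, hx] using hRsup x A) hA)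
  have hRP : ∀ A, risk psiZero m μ A ≤ twoSided ρ₀ ρ₁ (probRiskIntegrand psiZero m) A := fun A =>
    twoSided_mono
      (Eventually.of_forall fun x => riskIntegrand_le_probRiskIntegrand psiZero_le_one m x A)
      (Eventually.of_forall fun x => riskIntegrand_le_probRiskIntegrand psiZero_le_one m x Aᶜ)
  have hball : ∀ᵐ x ∂(dataMeasure μ), m x (Metric.ball x ε)ᶜ = 0 := by
    have hS : ∀ᵐ x ∂(dataMeasure μ), x ∈ (dataMeasure μ).support := hρ
    filter_upwards [hS] with x hx using h_ball x hx
  have hPA : ∀ A, twoSided ρ₀ ρ₁ (probRiskIntegrand psiZero m) A ≤ advRisk ε μ A := fun A => by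
    rw [advRisk_eq_twoSided]
    refine twoSided_mono ?_ ?_
    · filter_upwards [hac₀.ae_le hball] with x hx using probRiskIntegrand_psiZero_le hε hx A
    · filter_upwards [hac₁.ae_le hball] with x hx using probRiskIntegrand_psiZero_le hε hx Aᶜ
  have hAR := exists_advRisk_le_risk_psiZero μ m ε hm_prob hρ h_supp h_ac
  -- The modified risk also attains the minimum of the risk, which identifies the limit in `hPlim`
  -- with the common value.
  have hP0' := hR0.transfer (fun A _ => hRP A) fun A _ =>
    (hAR A).imp fun A' h => ⟨h.1, (hPA A').trans h.2⟩
  rw [hP0.unique hP0'] at hPlim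
  exact ⟨_, _, _, hR0.transfer (fun A _ => (hRP A).trans (hPA A)) fun A _ => hAR A, hR0,
    (isMinOverSets_congr fun A hA => probRisk_eq_twoSided psiZero m μ hA).2 hP0', hRp, hRlim,
    fun p hp => (isMinOverSets_congr fun A hA => probRisk_eq_twoSided (psi p) m μ hA).2 (hPp p hp),
    hPlim⟩
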